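/- Let $k$ be an algebraically closed field of characteristic zero, let $X$ be a scheme of finite type over $k$, and let $m \ge 0$ be an integer. An $m$-wedge of $X$ is a $k$-morphism $\operatorname{Spec} k[s,t]/(s,t)^{m+1} \to X$. Let $\mathcal{W}_m(X)$ be the $m$-th truncated wedge scheme of $X$. If $X = \operatorname{Spec} A$ is affine, it is the spectrum of the $k$-algebra generated by symbols $a^{(i,j)}$ ($a \in A$, $i,j \ge 0$, $i+j \le m$) subject to the relations given by the coefficients of $s^i t^j$, $i+j \le m$, in the equations which say that $a \mapsto \sum_{i+j\le m} a^{(i,j)} s^i t^j$ is a $k$-algebra homomorphism modulo $(s,t)^{m+1}$; thus its $R$-points are the $k$-algebra homomorphisms $A \to R[s,t]/(s,t)^{m+1}$, for every $k$-algebra $R$. In general $\mathcal{W}_m(X)$ is obtained by gluing these schemes over the affine open subschemes of $X$. Let $\pi_m : \mathcal{W}_m(X) \to X$ be the natural projection, given on affine pieces by $a \mapsto a^{(0,0)}$, which sends an $m$-wedge to its base point. Corollary (SmoothWedge). Suppose that $X$ is smooth over $k$ of (relative) dimension $n$. Then $\pi_m$ makes $\mathcal{W}_m(X)$ locally an $\mathbb{A}^{\frac{1}{2}nm(m+3)}$-bundle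 over $X$: every point of $X$ has an open neighbourhood $U$ such that $\pi_m^{-1}(U)$ is isomorphic, as a scheme over $U$, to $\mathbb{A}^{\frac{1}{2}nm(m+3)} \times U$. In particular, $\mathcal{W}_m(X)$ is smooth over $k$ of (relative) dimension $\frac{1}{2}n(m+1)(m+2)$. -/

import Mathlib

open CategoryTheory AlgebraicGeometry Opposite

universe u

noncomputable section

namespace Wedge

/-! ### The algebra of `m`-wedges of a `k`-algebra

An exponent `ν : Fin 2 →₀ ℕ` stands for the monomial `s ^ (ν 0) * t ^ (ν 1)`; the two variables of
`MvPolynomial (Fin 2) R` are `s` and `t`. -/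

/-- The exponents of the monomials in `s, t` of total degree at most `m`. -/
abbrev Exponent (m : ℕ) : Type := {ν : Fin 2 →₀ ℕ // ν.degree ≤ m}

instance (m : ℕ) : Fintype (Exponent m) := (Finsupp.finite_of_degree_le (σ := Fin 2) m).fintype

section Truncated

variable (R : Type*) [CommRing R] (m : ℕ)

/-- The truncated polynomial ring `R[s, t] / (s, t) ^ (m + 1)`. -/
abbrev TruncPoly : Type _ :=
  MvPolynomial (Fin 2) R ⧸ MvPolynomial.idealOfVars (Fin 2) R ^ (m + 1)

variable {R m}

/-- The coefficient of the monomial of exponent `ν` (of degree at most `m`) of an element of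
`R[s, t] / (s, t) ^ (m + 1)`. -/
def TruncPoly.coeff (ν : Exponent m) : TruncPoly R m →+ R :=
  QuotientAddGroup.lift _ (MvPolynomial.coeffAddMonoidHom ν.1) (fun p hp =>
    (MvPolynomial.mem_pow_idealOfVars_iff' (m + 1) p).1 hp ν.1 (Nat.lt_succ_of_le ν.2))

theorem TruncPoly.coeff_mk (ν : Exponent m) (p : MvPolynomial (Fin 2) R) :
    TruncPoly.coeff ν (Ideal.Quotient.mk _ p : TruncPoly R m) = p.coeff ν.1 := rfl

theorem TruncPoly.mk_eq_zero_iff (p : MvPolynomial (Fin 2) R) :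
    (Ideal.Quotient.mk _ p : TruncPoly R m) = 0 ↔ ∀ ν : Exponent m, p.coeff ν.1 = 0 := by
  rw [Ideal.Quotient.eq_zero_iff_mem, MvPolynomial.mem_pow_idealOfVars_iff']
  exact ⟨fun h ν => h ν.1 (Nat.lt_succ_of_le ν.2), fun h x hx => h ⟨x, Nat.le_of_lt_succ hx⟩⟩

theorem TruncPoly.ext {p q : TruncPoly R m}
    (h : ∀ ν : Exponent m, TruncPoly.coeff ν p = TruncPoly.coeff ν q) : p = q := by
  rw [← sub_eq_zero]
  have h' : ∀ ν : Exponent m, TruncPoly.coeff ν (p - q) = 0 := fun ν => by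
    rw [map_sub, h, sub_self]
  obtain ⟨r, hr⟩ := Ideal.Quotient.mk_surjective (p - q)
  rw [← hr] at h' ⊢
  exact (TruncPoly.mk_eq_zero_iff r).2 h'

variable {k : Type*} [CommRing k] [Algebra k R] {S : Type*} [CommRing S] [Algebra k S]

/-- The map `R[s, t] / (s, t) ^ (m + 1) → S[s, t] / (s, t) ^ (m + 1)` induced by `R → S`. -/
def TruncPoly.map (φ : R →ₐ[k] S) : TruncPoly R m →ₐ[k] TruncPoly S m :=
  Ideal.Quotient.liftₐ _
    ((Ideal.Quotient.mkₐ k (MvPolynomial.idealOfVars (Fin 2) S ^ (m + 1))).comp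
      (MvPolynomial.mapAlgHom φ)) (fun p hp => by
        refine (TruncPoly.mk_eq_zero_iff _).2 fun ν => ?_
        change MvPolynomial.coeff ν.1 (MvPolynomial.map (φ : R →+* S) p) = 0
        rw [MvPolynomial.coeff_map,
          (MvPolynomial.mem_pow_idealOfVars_iff' (m + 1) p).1 hp ν.1 (Nat.lt_succ_of_le ν.2),
          map_zero])

theorem TruncPoly.coeff_map (φ : R →ₐ[k] S) (p : TruncPoly R m) (ν : Exponent m) :
    TruncPoly.coeff ν (TruncPoly.map φ p) = φ (TruncPoly.coeff ν p) := by
  obtain ⟨p, rfl⟩ := Ideal.Quotient.mk_surjective p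
  exact MvPolynomial.coeff_map _ _ _

/-- The `k`-algebra map `R[s, t] / (s, t) ^ (m + 1) → R` with `s, t ↦ 0`. -/
def TruncPoly.const : TruncPoly R m →ₐ[k] R :=
  Ideal.Quotient.liftₐ _ ((MvPolynomial.aeval (0 : Fin 2 → R)).restrictScalars k) (fun p hp => by
    have := (MvPolynomial.mem_pow_idealOfVars_iff' (m + 1) p).1 hp 0 (by simp)
    simpa [MvPolynomial.aeval_zero, MvPolynomial.constantCoeff_eq] using this)

theorem TruncPoly.const_apply (p : TruncPoly R m) :
    TruncPoly.const (k := k) p = TruncPoly.coeff ⟨0, by simp⟩ p := by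
  obtain ⟨p, rfl⟩ := Ideal.Quotient.mk_surjective p
  rw [TruncPoly.coeff_mk]
  simp [TruncPoly.const, MvPolynomial.constantCoeff_eq]

theorem TruncPoly.isUnit_of_const {p : TruncPoly R m}
    (h : IsUnit (TruncPoly.coeff ⟨0, by simp⟩ p)) : IsUnit p := by
  obtain ⟨p, rfl⟩ := Ideal.Quotient.mk_surjective p
  rw [TruncPoly.coeff_mk] at h
  have hI : p - MvPolynomial.C (p.coeff 0) ∈ MvPolynomial.idealOfVars (Fin 2) R := by
    rw [← pow_one (MvPolynomial.idealOfVars (Fin 2) R), MvPolynomial.mem_pow_idealOfVars_iff']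
    intro x hx
    obtain rfl : x = 0 := (Finsupp.degree_eq_zero_iff x).1 (by lia)
    simp
  have hn : IsNilpotent (Ideal.Quotient.mk (MvPolynomial.idealOfVars (Fin 2) R ^ (m + 1))
      (p - MvPolynomial.C (p.coeff 0))) :=
    ⟨m + 1, by
      rw [← map_pow, Ideal.Quotient.eq_zero_iff_mem]
      exact Ideal.pow_mem_pow hI _⟩
  have hu : IsUnit (Ideal.Quotient.mk (MvPolynomial.idealOfVars (Fin 2) R ^ (m + 1))
      (MvPolynomial.C (p.coeff 0))) := (h.map MvPolynomial.C).map _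
  have := hn.isUnit_add_left_of_commute hu (Commute.all _ _)
  rwa [← map_add, add_sub_cancel] at this

end Truncated

section Algebra

variable (k A : Type*) [CommRing k] [CommRing A] [Algebra k A] (m : ℕ)

/-- The polynomial ring over `k` on indeterminates `x_a ^ (i, j)`, one for each `a ∈ A` and each
`(i, j)` with `i + j ≤ m`. -/
abbrev CoordRing : Type _ := MvPolynomial (A × Exponent m) k

variable {A} in
/-- The generic polynomial `∑_{i + j ≤ m} x_a ^ (i, j) s ^ i t ^ j` attached to `a ∈ A`. -/
def generic (a : A) : MvPolynomial (Fin 2) (CoordRing k A m) :=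
  ∑ ν : Exponent m, MvPolynomial.monomial ν.1 (MvPolynomial.X (a, ν))

theorem coeff_map_generic {k A R : Type*} [CommRing k] [CommRing R] {m : ℕ}
    (ψ : CoordRing k A m →+* R) (a : A) (ν : Exponent m) :
    (MvPolynomial.map ψ (generic k m a)).coeff ν.1 = ψ (MvPolynomial.X (a, ν)) := by
  classical
  rw [MvPolynomial.coeff_map, generic, MvPolynomial.coeff_sum]
  congr 1
  rw [Finset.sum_eq_single ν]
  · simp
  · intro b _ hb
    rw [MvPolynomial.coeff_monomial, if_neg (fun h => hb (Subtype.ext h))]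
  · simp

/-- The ideal of `k[x_a ^ (i, j)]` generated by the coefficients of `s ^ i t ^ j`, `i + j ≤ m`, in
the equations which say that `a ↦ ∑ x_a ^ (i, j) s ^ i t ^ j` is additive, multiplicative, and
the identity on constants. -/
def relationIdeal : Ideal (CoordRing k A m) :=
  Ideal.span
    ({p | ∃ (a b : A) (ν : Exponent m),
        p = (generic k m (a + b) - (generic k m a + generic k m b)).coeff ν.1} ∪
     {p | ∃ (a b : A) (ν : Exponent m),
        p = (generic k m (a * b) - generic k m a * generic k m b).coeff ν.1} ∪
     {p | ∃ (c : k) (ν : Exponent m),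
        p = (generic k m (algebraMap k A c) - MvPolynomial.C (MvPolynomial.C c)).coeff ν.1})

/-- The coordinate ring of the `m`-th truncated wedge scheme of `Spec A` over `k`: its `k`-algebra
maps to `R` are the `k`-algebra maps `A → R[s, t] / (s, t) ^ (m + 1)` (see `homEquiv`). -/
abbrev WedgeAlgebra : Type _ := CoordRing k A m ⧸ relationIdeal k A m

variable {A m}

/-- The class of the indeterminate `x_a ^ (i, j)` in the wedge algebra. -/
def coordinate (a : A) (ν : Exponent m) : WedgeAlgebra k A m :=
  Ideal.Quotient.mk _ (MvPolynomial.X (a, ν))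

/-- Auxiliary: the value at `a` of the universal `m`-wedge. -/
def universalFun (a : A) : TruncPoly (WedgeAlgebra k A m) m :=
  Ideal.Quotient.mk _ (MvPolynomial.map (Ideal.Quotient.mk (relationIdeal k A m)) (generic k m a))

variable {k} in
theorem mk_map_eq_of_coeff_sub_mem {p q : MvPolynomial (Fin 2) (CoordRing k A m)}
    (h : ∀ ν : Exponent m, (p - q).coeff ν.1 ∈ relationIdeal k A m) :
    (Ideal.Quotient.mk _ (MvPolynomial.map (Ideal.Quotient.mk (relationIdeal k A m)) p) :
      TruncPoly (WedgeAlgebra k A m) m) =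
    Ideal.Quotient.mk _ (MvPolynomial.map (Ideal.Quotient.mk (relationIdeal k A m)) q) := by
  rw [← sub_eq_zero, ← map_sub, ← map_sub, TruncPoly.mk_eq_zero_iff]
  intro ν
  rw [MvPolynomial.coeff_map]
  exact Ideal.Quotient.eq_zero_iff_mem.2 (h ν)

theorem universalFun_add (a b : A) :
    universalFun k (m := m) (a + b) = universalFun k a + universalFun k b := by
  unfold universalFun
  rw [← map_add, ← map_add]
  exact mk_map_eq_of_coeff_sub_mem fun ν => Ideal.subset_span (Or.inl (Or.inl ⟨a, b, ν, rfl⟩))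

theorem universalFun_mul (a b : A) :
    universalFun k (m := m) (a * b) = universalFun k a * universalFun k b := by
  unfold universalFun
  rw [← map_mul, ← map_mul]
  exact mk_map_eq_of_coeff_sub_mem fun ν => Ideal.subset_span (Or.inl (Or.inr ⟨a, b, ν, rfl⟩))

theorem universalFun_algebraMap (c : k) :
    universalFun k (m := m) (algebraMap k A c) = algebraMap k _ c := by
  have h : universalFun k (m := m) (algebraMap k A c) = Ideal.Quotient.mk _
      (MvPolynomial.map (Ideal.Quotient.mk (relationIdeal k A m))
        (MvPolynomial.C (MvPolynomial.C c))) :=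
    mk_map_eq_of_coeff_sub_mem fun ν => Ideal.subset_span (Or.inr ⟨c, ν, rfl⟩)
  rw [h, MvPolynomial.map_C]
  rfl

/-- The universal `m`-wedge `A → W[s, t] / (s, t) ^ (m + 1)`, `a ↦ ∑ x_a ^ (i, j) s ^ i t ^ j`,
where `W` is the wedge algebra of `A`. -/
def universal : A →ₐ[k] TruncPoly (WedgeAlgebra k A m) m where
  toFun := universalFun k
  map_one' := by simpa using universalFun_algebraMap k (A := A) (m := m) 1
  map_mul' := universalFun_mul k
  map_zero' := by simpa using universalFun_algebraMap k (A := A) (m := m) 0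
  map_add' := universalFun_add k
  commutes' := universalFun_algebraMap k

theorem coeff_universal (a : A) (ν : Exponent m) :
    TruncPoly.coeff ν (universal k (m := m) a) = coordinate k a ν :=
  coeff_map_generic (Ideal.Quotient.mk (relationIdeal k A m)) a ν

variable {k}
variable {R : Type*} [CommRing R] [Algebra k R]

theorem algHom_ext {φ ψ : WedgeAlgebra k A m →ₐ[k] R}
    (h : ∀ a ν, φ (coordinate k a ν) = ψ (coordinate k a ν)) : φ = ψ := by
  apply Ideal.Quotient.algHom_ext
  apply MvPolynomial.algHom_ext
  rintro ⟨a, ν⟩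
  exact h a ν

theorem mk_map_generic (g : A →ₐ[k] TruncPoly R m) (a : A) :
    (Ideal.Quotient.mk _ (MvPolynomial.map
      (MvPolynomial.aeval (R := k) fun y : A × Exponent m => TruncPoly.coeff y.2 (g y.1) :
        CoordRing k A m →ₐ[k] R).toRingHom (generic k m a)) : TruncPoly R m) = g a := by
  apply TruncPoly.ext
  intro ν
  rw [TruncPoly.coeff_mk, coeff_map_generic]
  simp

/-- The map out of the wedge algebra classifying an `m`-wedge
`g : A → R[s, t] / (s, t) ^ (m + 1)`; it sends `x_a ^ (i, j)` to the coefficient of `s ^ i t ^ j`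
in `g a`. -/
def desc (g : A →ₐ[k] TruncPoly R m) : WedgeAlgebra k A m →ₐ[k] R :=
  Ideal.Quotient.liftₐ _
    (MvPolynomial.aeval fun y : A × Exponent m => TruncPoly.coeff y.2 (g y.1)) (by
      set ψ : CoordRing k A m →ₐ[k] R :=
        MvPolynomial.aeval fun y : A × Exponent m => TruncPoly.coeff y.2 (g y.1) with hψ
      have hg := mk_map_generic g
      have key : ∀ p q : MvPolynomial (Fin 2) (CoordRing k A m),
          (Ideal.Quotient.mk _ (MvPolynomial.map ψ.toRingHom p) : TruncPoly R m) =
            Ideal.Quotient.mk _ (MvPolynomial.map ψ.toRingHom q) →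
          ∀ ν : Exponent m, (p - q).coeff ν.1 ∈ RingHom.ker ψ := by
        intro p q h ν
        rw [← sub_eq_zero, ← map_sub, ← map_sub, TruncPoly.mk_eq_zero_iff] at h
        have := h ν
        rwa [MvPolynomial.coeff_map] at this
      suffices h : relationIdeal k A m ≤ RingHom.ker ψ from fun a ha => h ha
      refine Ideal.span_le.2 ?_
      rintro p ((⟨a, b, ν, rfl⟩ | ⟨a, b, ν, rfl⟩) | ⟨c, ν, rfl⟩)
      · refine key _ _ ?_ ν
        rw [map_add, map_add, hg, hg, hg, map_add]
      · refine key _ _ ?_ ν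
        rw [map_mul, map_mul, hg, hg, hg, map_mul]
      · refine key _ _ ?_ ν
        rw [hg, AlgHom.commutes, MvPolynomial.map_C]
        have : ψ.toRingHom (MvPolynomial.C c) = algebraMap k R c := ψ.commutes c
        rw [this]
        rfl)

theorem desc_coordinate (g : A →ₐ[k] TruncPoly R m) (a : A) (ν : Exponent m) :
    desc g (coordinate k a ν) = TruncPoly.coeff ν (g a) := by
  change MvPolynomial.aeval (R := k) _ (MvPolynomial.X (a, ν)) = _
  rw [MvPolynomial.aeval_X]

/-- The universal property of the wedge algebra: its `R`-points are the `R`-valued `m`-wedges of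
`Spec A`. -/
def homEquiv : (WedgeAlgebra k A m →ₐ[k] R) ≃ (A →ₐ[k] TruncPoly R m) where
  toFun φ := (TruncPoly.map φ).comp (universal k)
  invFun := desc
  left_inv φ := algHom_ext fun a ν => by
    rw [desc_coordinate, AlgHom.comp_apply, TruncPoly.coeff_map, coeff_universal]
  right_inv g := AlgHom.ext fun a => TruncPoly.ext fun ν => by
    rw [AlgHom.comp_apply, TruncPoly.coeff_map, coeff_universal, desc_coordinate]

variable {B : Type*} [CommRing B] [Algebra k B]

/-- Functoriality of the wedge algebra: `x_a ^ (i, j) ↦ x_{h a} ^ (i, j)`. -/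
def mapAlg (m : ℕ) (h : A →ₐ[k] B) : WedgeAlgebra k A m →ₐ[k] WedgeAlgebra k B m :=
  desc ((universal k).comp h)

theorem mapAlg_coordinate (h : A →ₐ[k] B) (a : A) (ν : Exponent m) :
    mapAlg m h (coordinate k a ν) = coordinate k (h a) ν := by
  rw [mapAlg, desc_coordinate, AlgHom.comp_apply, coeff_universal]

variable (k A m) in
/-- The structure map `A → W`, `a ↦ x_a ^ (0, 0)`, of the wedge algebra `W` of `A`; it is dual to
the projection that sends an `m`-wedge to its base point. -/
def base : A →ₐ[k] WedgeAlgebra k A m := TruncPoly.const.comp (universal k)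

theorem base_apply (a : A) : base k A m a = coordinate k a ⟨0, by simp⟩ := by
  rw [base, AlgHom.comp_apply, TruncPoly.const_apply, coeff_universal]

theorem mapAlg_base (h : A →ₐ[k] B) (a : A) : mapAlg m h (base k A m a) = base k B m (h a) := by
  rw [base_apply, base_apply, mapAlg_coordinate]

/-- Formation of the wedge algebra commutes with localization at one element. -/
theorem isLocalization_mapAlg (h : A →ₐ[k] B) (r : A)
    (hr : letI := h.toRingHom.toAlgebra; IsLocalization.Away r B) :
    letI := (mapAlg m h).toRingHom.toAlgebra
    IsLocalization.Away (base k A m r) (WedgeAlgebra k B m) := by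
  let algAB : Algebra A B := h.toRingHom.toAlgebra
  let algW : Algebra (WedgeAlgebra k A m) (WedgeAlgebra k B m) := (mapAlg m h).toRingHom.toAlgebra
  have : IsLocalization.Away r B := hr
  have : IsScalarTower k A B := .of_algebraMap_eq fun c => (h.commutes c).symm
  have : IsScalarTower k (WedgeAlgebra k A m) (WedgeAlgebra k B m) :=
    .of_algebraMap_eq fun c => ((mapAlg m h).commutes c).symm
  let L := Localization.Away (base k A m r)
  let ι : WedgeAlgebra k A m →ₐ[k] L := IsScalarTower.toAlgHom k _ L
  have hunit : IsUnit (algebraMap _ (WedgeAlgebra k B m) (base k A m r)) := by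
    change IsUnit (mapAlg m h (base k A m r))
    rw [mapAlg_base]
    exact (IsLocalization.Away.algebraMap_isUnit (S := B) r).map (base k B m)
  have hG : IsUnit (((TruncPoly.map ι).comp (universal k (m := m))) r) := by
    apply TruncPoly.isUnit_of_const
    rw [AlgHom.comp_apply, TruncPoly.coeff_map, coeff_universal, ← base_apply]
    exact IsLocalization.Away.algebraMap_isUnit (S := L) (base k A m r)
  let G : B →ₐ[k] TruncPoly L m := IsLocalization.liftAlgHom (M := Submonoid.powers r)
    (f := (TruncPoly.map ι).comp (universal k (m := m))) (by
      rintro ⟨_, j, rfl⟩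
      simpa only [map_pow] using hG.pow j)
  have hGh : ∀ a, G (h a) = TruncPoly.map ι (universal k a) := fun a =>
    IsLocalization.lift_eq _ a
  let F : L →ₐ[WedgeAlgebra k A m] WedgeAlgebra k B m :=
    IsLocalization.liftAlgHom (M := Submonoid.powers (base k A m r))
      (f := Algebra.ofId (WedgeAlgebra k A m) (WedgeAlgebra k B m)) (by
        rintro ⟨_, j, rfl⟩
        rw [map_pow]
        exact hunit.pow j)
  have hFι : ∀ w, F (ι w) = mapAlg m h w := fun w => F.commutes w
  have hD : ∀ w, desc G (mapAlg m h w) = ι w := by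
    have : (desc G).comp (mapAlg m h) = ι := algHom_ext fun a ν => by
      rw [AlgHom.comp_apply, mapAlg_coordinate, desc_coordinate, hGh, TruncPoly.coeff_map,
        coeff_universal]
    exact fun w => DFunLike.congr_fun this w
  have hFD : ((F.restrictScalars k).comp (desc G)) = AlgHom.id k _ := by
    apply homEquiv.injective
    refine IsLocalization.algHom_ext (Submonoid.powers r) ?_
    refine AlgHom.ext fun a => TruncPoly.ext fun ν => ?_
    change TruncPoly.coeff ν (TruncPoly.map _ (universal k (h a))) =
      TruncPoly.coeff ν (TruncPoly.map _ (universal k (h a)))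
    rw [TruncPoly.coeff_map, TruncPoly.coeff_map, coeff_universal, ← mapAlg_coordinate]
    exact (congrArg F (hD _)).trans (hFι _)
  let D : WedgeAlgebra k B m →ₐ[WedgeAlgebra k A m] L :=
    { (desc G).toRingHom with commutes' := fun w => hD w }
  have h1 : D.comp F = AlgHom.id _ L :=
    IsLocalization.algHom_ext (Submonoid.powers (base k A m r)) (by ext)
  have h2 : F.comp D = AlgHom.id _ _ := AlgHom.ext fun w => DFunLike.congr_fun hFD w
  exact IsLocalization.isLocalization_of_algEquiv _ (AlgEquiv.ofAlgHom F D h2 h1)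

end Algebra

/-! ### The truncated wedge scheme of a scheme over `k` -/

section Schemes

variable {k : Type u} [CommRing k] {X : Scheme.{u}} (f : X ⟶ Spec (.of k)) (m : ℕ)

/-- The `k`-algebra structure on the sections over `U` of a scheme `f : X ⟶ Spec k`. -/
abbrev sectionsAlgebra (U : X.Opens) : Algebra k Γ(X, U) :=
  ((Scheme.ΓSpecIso (.of k)).inv ≫ f.appLE ⊤ U (le_top : U ≤ f ⁻¹ᵁ ⊤)).hom.toAlgebra

/-- Restriction of sections, as a map of `k`-algebras. -/
def restrictAlg {U V : X.Opens} (h : V ≤ U) :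
    letI := sectionsAlgebra f U
    letI := sectionsAlgebra f V
    Γ(X, U) →ₐ[k] Γ(X, V) :=
  letI := sectionsAlgebra f U
  letI := sectionsAlgebra f V
  { (X.presheaf.map (homOfLE h).op).hom with
    commutes' := fun c => by
      have := f.appLE_map (U := ⊤) (le_top : U ≤ f ⁻¹ᵁ ⊤) (homOfLE h).op
      exact congrArg (fun φ => ((Scheme.ΓSpecIso (.of k)).inv ≫ φ).hom c) this }

/-- The presheaf of rings on `X` whose value at `U` is the wedge algebra of the `k`-algebra of
sections over `U`. -/
def wedgeDiagram : X.Opensᵒᵖ ⥤ CommRingCat.{u} where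
  obj U :=
    letI := sectionsAlgebra f U.unop
    .of (WedgeAlgebra k Γ(X, U.unop) m)
  map {U V} i :=
    letI := sectionsAlgebra f U.unop
    letI := sectionsAlgebra f V.unop
    CommRingCat.ofHom (mapAlg m (restrictAlg f i.unop.le)).toRingHom
  map_id U := by
    let := sectionsAlgebra f U.unop
    have : mapAlg m (restrictAlg f (le_refl U.unop)) = AlgHom.id k _ :=
      algHom_ext fun a ν => by
        rw [mapAlg_coordinate]
        exact congrArg (fun b => coordinate k b ν)
          (congrArg (fun φ => φ.hom a) (X.presheaf.map_id U))
    exact congrArg (fun φ => CommRingCat.ofHom (AlgHom.toRingHom φ)) this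
  map_comp {U V W} i j := by
    let := sectionsAlgebra f U.unop
    let := sectionsAlgebra f V.unop
    let := sectionsAlgebra f W.unop
    have : mapAlg m (restrictAlg f (i ≫ j).unop.le) =
        (mapAlg m (restrictAlg f j.unop.le)).comp (mapAlg m (restrictAlg f i.unop.le)) :=
      algHom_ext fun a ν => by
        rw [AlgHom.comp_apply, mapAlg_coordinate, mapAlg_coordinate, mapAlg_coordinate]
        exact congrArg (fun b => coordinate k b ν)
          (congrArg (fun φ => φ.hom a) (X.presheaf.map_comp i j))
    exact congrArg (fun φ => CommRingCat.ofHom (AlgHom.toRingHom φ)) this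

/-- The structure map from the functions on `X` to the presheaf of wedge algebras. -/
def wedgeDiagramMap : X.presheaf ⟶ wedgeDiagram f m where
  app U :=
    letI := sectionsAlgebra f U.unop
    CommRingCat.ofHom (base k Γ(X, U.unop) m).toRingHom
  naturality U V i := by
    let := sectionsAlgebra f U.unop
    let := sectionsAlgebra f V.unop
    ext a
    exact (mapAlg_base (restrictAlg f i.unop.le) a).symm

open Scheme.AffineZariskiSite in
theorem coequifibered_wedgeDiagramMap :
    ((toOpensFunctor X).op.whiskerLeft (wedgeDiagramMap f m)).Coequifibered := by
  refine coequifibered_iff_forall_isLocalizationAway.mpr fun U r => ?_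
  let := sectionsAlgebra f U.1
  let := sectionsAlgebra f (X.basicOpen r)
  exact isLocalization_mapAlg (m := m) (restrictAlg f (X.basicOpen_le r)) r
    (U.2.isLocalization_basicOpen r)

/-- The diagram of the affine schemes `Spec` of the wedge algebra of `Γ(X, U)`, for `U` an affine
open of `X`, from which the truncated wedge scheme is glued. -/
def wedgeGlueData : (Scheme.AffineZariskiSite.directedCover X).RelativeGluingData :=
  Scheme.AffineZariskiSite.relativeGluingData (coequifibered_wedgeDiagramMap f m)

/-- The `m`-th truncated wedge scheme `W_m(X)` of a scheme `f : X ⟶ Spec k` over `k`. -/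
def wedgeScheme : Scheme.{u} := (wedgeGlueData f m).glued

/-- The projection `π_m : W_m(X) ⟶ X`, which sends an `m`-wedge to its base point. -/
def wedgeProj : wedgeScheme f m ⟶ X := (wedgeGlueData f m).toBase

end Schemes

/-- The morphism `p : Y ⟶ X` is (Zariski-)locally on `X` an `𝔸 ^ r`-bundle: `X` is covered by open
subschemes `U` such that `p ⁻¹ U` is isomorphic over `U` to the affine space `𝔸 ^ r × U`. -/
def IsLocallyAffineBundle {X Y : Scheme.{u}} (p : Y ⟶ X) (r : ℕ) : Prop :=
  ∀ x : X, ∃ U : X.Opens, x ∈ U ∧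
    ∃ e : (p ⁻¹ᵁ U).toScheme ≅ AffineSpace (ULift.{u} (Fin r)) U.toScheme,
      e.hom ≫ (AffineSpace (ULift.{u} (Fin r)) U.toScheme ↘ U.toScheme) = p ∣_ U

end Wedge

end

/-! The map `TruncPoly.const`, from the truncated polynomial ring onto `R`, is surjective with
nilpotent kernel, so wedges are infinitesimal thickenings of points. If `Spec A` is étale over `𝔸 ^
n`, unique infinitesimal lifting shows that a wedge of `Spec A` amounts to a base point in `Spec A`
and a wedge of `𝔸 ^ n` through its image (`exists_wedge_lift`, `wedge_ext`). A wedge of `𝔸 ^ n` is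
any choice of `n` truncated polynomials; once the base point is fixed, what remains free is their
nonconstant coefficients. Hence the wedge algebra of `A` is a polynomial ring over `A` in `n * (m *
(m + 3) / 2)` variables (`exists_wedgeAlgebra_equiv`, `card_posExponent`).

A smooth `X` has étale coordinates locally (`exists_etale_coordinates`), and over an affine open
`π_m` is `Spec` of `base` (`exists_preimage_iso`); this gives the bundle. Smoothness over `k`
follows because affine space is smooth, smoothness is local on the target, and relative dimensions
add under composition. -/

/-- Infinitesimal lifting for a formally étale ring homomorphism: a commutative square against a
surjection with nilpotent kernel has a unique diagonal filler. -/
theorem RingHom.FormallyEtale.existsUnique_lift {P A B C : Type*} [CommRing P] [CommRing A]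
    [CommRing B] [CommRing C] {g : P →+* A} (hg : g.FormallyEtale) {q : B →+* C}
    (hq : Function.Surjective q) (hn : IsNilpotent (RingHom.ker q)) {p : P →+* B} {φ : A →+* C}
    (h : q.comp p = φ.comp g) : ∃! G : A →+* B, G.comp g = p ∧ q.comp G = φ := by
  -- With `C` a `P`-algebra through `q.comp p`, `q` is `P`-linear by definition and `φ` is
  -- `P`-linear by commutativity of the square.
  algebraize [g, p, q.comp p]
  have : Algebra.FormallyEtale P A := hg
  let q' : B →ₐ[P] C := { q with commutes' := fun _ => rfl }
  let φ' : A →ₐ[P] C := { φ with commutes' := fun x => (RingHom.congr_fun h x).symm }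
  have hn' : IsNilpotent (RingHom.ker q') := hn
  refine ⟨(Algebra.FormallySmooth.liftOfSurjective φ' q' hq hn').toRingHom,
    ⟨(Algebra.FormallySmooth.liftOfSurjective φ' q' hq hn').comp_algebraMap,
      RingHom.ext (Algebra.FormallySmooth.liftOfSurjective_apply φ' q' hq hn')⟩, ?_⟩
  rintro G ⟨hG, hG'⟩
  let G' : A →ₐ[P] B := { G with commutes' := RingHom.congr_fun hG }
  have : G' = Algebra.FormallySmooth.liftOfSurjective φ' q' hq hn' :=
    Algebra.FormallyUnramified.lift_unique_of_ringHom q hn _ _ (RingHom.ext fun x =>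
      (RingHom.congr_fun hG' x).trans
        (Algebra.FormallySmooth.liftOfSurjective_apply φ' q' hq hn' x).symm)
  exact congrArg AlgHom.toRingHom this

namespace Wedge

/-! ### Truncated polynomials as a nilpotent thickening -/

section Truncated

variable {R : Type*} [CommRing R] {m : ℕ}

/-- The truncated polynomial with prescribed coefficients. -/
noncomputable def TruncPoly.ofCoeff (c : Exponent m → R) : TruncPoly R m :=
  Ideal.Quotient.mk _ (∑ ν : Exponent m, MvPolynomial.monomial ν.1 (c ν))

theorem TruncPoly.coeff_ofCoeff (c : Exponent m → R) (ν : Exponent m) :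
    TruncPoly.coeff ν (TruncPoly.ofCoeff c) = c ν := by
  classical
  rw [ofCoeff, coeff_mk, MvPolynomial.coeff_sum, Finset.sum_eq_single ν]
  · simp
  · intro b _ hb
    rw [MvPolynomial.coeff_monomial, if_neg (fun h => hb (Subtype.ext h))]
  · simp

variable {k : Type*} [CommRing k] [Algebra k R]

theorem TruncPoly.const_surjective :
    Function.Surjective (TruncPoly.const : TruncPoly R m →ₐ[k] R) := fun r =>
  ⟨ofCoeff fun _ => r, by rw [const_apply, coeff_ofCoeff]⟩

/-- A truncated polynomial without constant term lies in the image of `(s, t)`, and `(s, t) ^ (m +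
1)` dies in the quotient. -/
theorem TruncPoly.isNilpotent_ker_const :
    IsNilpotent (RingHom.ker (TruncPoly.const : TruncPoly R m →ₐ[k] R)) := by
  refine ⟨m + 1, ?_⟩
  have h : RingHom.ker (TruncPoly.const : TruncPoly R m →ₐ[k] R) ≤
      (MvPolynomial.idealOfVars (Fin 2) R).map (Ideal.Quotient.mk _) := by
    intro p hp
    obtain ⟨p, rfl⟩ := Ideal.Quotient.mk_surjective p
    rw [RingHom.mem_ker, const_apply, coeff_mk] at hp
    refine Ideal.mem_map_of_mem _ ?_
    rw [← pow_one (MvPolynomial.idealOfVars (Fin 2) R), MvPolynomial.mem_pow_idealOfVars_iff']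
    intro x hx
    obtain rfl : x = 0 := (Finsupp.degree_eq_zero_iff x).1 (by lia)
    exact hp
  rw [Ideal.zero_eq_bot, eq_bot_iff]
  refine (Ideal.pow_right_mono h _).trans ?_
  rw [← Ideal.map_pow, Ideal.map_quotient_self]

end Truncated

/-! ### Lifting wedges along étale maps -/

section Lift

variable {k P A R : Type*} [CommRing k] [CommRing P] [CommRing A] [CommRing R] [Algebra k P]
  [Algebra k A] [Algebra k R] {m : ℕ}

/-- Along a formally étale algebra map `P → A`, an `m`-wedge of `Spec P` lifts to `Spec A` as soon
as its base point does. -/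
theorem exists_wedge_lift {g : P →ₐ[k] A} (hg : g.toRingHom.FormallyEtale)
    {p : P →ₐ[k] TruncPoly R m} {φ : A →ₐ[k] R} (h : TruncPoly.const.comp p = φ.comp g) :
    ∃ G : A →ₐ[k] TruncPoly R m, G.comp g = p ∧ TruncPoly.const.comp G = φ := by
  obtain ⟨G, ⟨hG, hG'⟩, -⟩ := hg.existsUnique_lift (q := (TruncPoly.const (k := k)).toRingHom)
    TruncPoly.const_surjective (TruncPoly.isNilpotent_ker_const (k := k)) (p := p.toRingHom)
    (φ := φ.toRingHom) (congrArg AlgHom.toRingHom h)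
  have hGg (x : P) : G (g x) = p x := RingHom.congr_fun hG x
  -- The lift is so far only a ring map; it is `k`-linear because the constants of `A` come from
  -- `P`.
  have hGk (c : k) : G (algebraMap k A c) = algebraMap k _ c := by
    rw [← g.commutes, hGg, p.commutes]
  exact ⟨{ G with commutes' := hGk }, AlgHom.ext hGg, AlgHom.ext fun x => RingHom.congr_fun hG' x⟩

/-- Along a formally étale algebra map `P → A`, an `m`-wedge of `Spec A` is determined by its base
point and its image in `Spec P`. -/
theorem wedge_ext {g : P →ₐ[k] A} (hg : g.toRingHom.FormallyEtale)
    {G₁ G₂ : A →ₐ[k] TruncPoly R m} (h : G₁.comp g = G₂.comp g)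
    (h' : (TruncPoly.const (k := k)).comp G₁ = TruncPoly.const.comp G₂) : G₁ = G₂ := by
  refine AlgHom.coe_ringHom_injective <| (hg.existsUnique_lift
    (q := (TruncPoly.const (k := k)).toRingHom)
    TruncPoly.const_surjective (TruncPoly.isNilpotent_ker_const (k := k))
    (p := (G₂.comp g).toRingHom) (φ := (TruncPoly.const.comp G₂).toRingHom) rfl).unique
    ⟨congrArg AlgHom.toRingHom h, congrArg AlgHom.toRingHom h'⟩ ⟨rfl, rfl⟩

end Lift

/-- The exponents of the nonconstant monomials of total degree at most `m`. -/
abbrev PosExponent (m : ℕ) : Type := {ν : Exponent m // ν.1 ≠ 0}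

/-! ### The wedge algebra in étale coordinates -/

section Coordinates

open MvPolynomial

variable {k A σ : Type*} [CommRing k] [CommRing A] [Algebra k A]

/-- The wedge algebra of an algebra that is formally étale over a polynomial ring is a polynomial
ring over that algebra. -/
theorem exists_wedgeAlgebra_equiv {g : MvPolynomial σ k →ₐ[k] A}
    (hg : g.toRingHom.FormallyEtale) (m : ℕ) :
    ∃ e : MvPolynomial (σ × PosExponent m) A ≃ₐ[k] WedgeAlgebra k A m,
      ∀ a, e (C a) = base k A m a := by
  classical
  -- Coefficients of the generic wedge of affine space over a point of `Spec A`: the constant ones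
  -- are forced by the base point, the others are free variables.
  let c (i : σ) (ν : Exponent m) : MvPolynomial (σ × PosExponent m) A :=
    if h : ν.1 = 0 then C (g (X i)) else X (i, ⟨ν, h⟩)
  let p : MvPolynomial σ k →ₐ[k] TruncPoly (MvPolynomial (σ × PosExponent m) A) m :=
    aeval fun i => TruncPoly.ofCoeff (c i)
  obtain ⟨G, hGp, hGc⟩ := exists_wedge_lift (m := m) hg (p := p)
    (φ := IsScalarTower.toAlgHom k A (MvPolynomial (σ × PosExponent m) A)) <| by
      refine MvPolynomial.algHom_ext fun i => ?_
      simp [p, TruncPoly.const_apply, TruncPoly.coeff_ofCoeff, c, algebraMap_eq]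
  have hG0 (a : A) : TruncPoly.coeff ⟨0, by simp⟩ (G a) = C a := by
    rw [← TruncPoly.const_apply (k := k)]
    exact DFunLike.congr_fun hGc a
  have hGX (i : σ) (ν : Exponent m) : TruncPoly.coeff ν (G (g (X i))) = c i ν := by
    rw [← AlgHom.comp_apply, hGp, aeval_X, TruncPoly.coeff_ofCoeff]
  let F : MvPolynomial (σ × PosExponent m) A →ₐ[k] WedgeAlgebra k A m :=
    aevalTower (base k A m) fun y => coordinate k (g (X y.1)) y.2.1
  have hFC (a : A) : F (C a) = base k A m a := aevalTower_C _ _ _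
  have h1 : (desc G).comp F = AlgHom.id k (MvPolynomial (σ × PosExponent m) A) := by
    refine MvPolynomial.algHom_ext' ?_ ?_
    · ext a
      simp [F, base_apply, desc_coordinate, hG0]
    · rintro ⟨i, ν, hν⟩
      simp [F, desc_coordinate, hGX, c, hν]
  have h2 : F.comp (desc G) = AlgHom.id k (WedgeAlgebra k A m) := by
    -- Maps out of the wedge algebra are compared through the wedges they classify, hence only on
    -- the étale coordinates and at the base point.
    refine homEquiv.injective (wedge_ext hg ?_ ?_)
    · refine MvPolynomial.algHom_ext fun i => TruncPoly.ext fun ν => ?_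
      change TruncPoly.coeff ν (TruncPoly.map _ (universal k (g (X i)))) =
        TruncPoly.coeff ν (TruncPoly.map _ (universal k (g (X i))))
      rw [TruncPoly.coeff_map, TruncPoly.coeff_map, coeff_universal, AlgHom.comp_apply,
        desc_coordinate, hGX, AlgHom.id_apply]
      obtain ⟨ν, hν⟩ := ν
      by_cases h : ν = 0
      · subst h
        simp [c, hFC, base_apply]
      · simp [c, h, F]
    · refine AlgHom.ext fun a => ?_
      change TruncPoly.const (k := k) (TruncPoly.map _ (universal k a)) =
        TruncPoly.const (k := k) (TruncPoly.map _ (universal k a))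
      rw [TruncPoly.const_apply, TruncPoly.const_apply, TruncPoly.coeff_map, TruncPoly.coeff_map,
        coeff_universal, AlgHom.comp_apply, desc_coordinate, hG0, hFC, AlgHom.id_apply, base_apply]
  exact ⟨AlgEquiv.ofAlgHom F (desc G) h2 h1, hFC⟩

end Coordinates

/-! ### Counting monomials -/

section Cardinality

/-- An exponent of degree at most `m` is given by its degree and its first entry. -/
noncomputable def exponentEquivSigma (m : ℕ) : Exponent m ≃ (d : Fin (m + 1)) × Fin (d + 1) where
  toFun ν := ⟨⟨ν.1.degree, Nat.lt_succ_of_le ν.2⟩, ⟨ν.1 0, Nat.lt_succ_of_le (ν.1.le_degree 0)⟩⟩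
  -- The natural subtraction is exact, since the first entry is at most the degree.
  invFun x := ⟨Finsupp.equivFunOnFinite.symm ![x.2, x.1 - x.2], by
    have := x.1.2; have := x.2.2
    simp [Finsupp.degree_eq_sum]
    lia⟩
  left_inv ν := by
    ext i
    fin_cases i <;> simp [Finsupp.degree_eq_sum]
  right_inv x := by
    obtain ⟨⟨d, hd⟩, ⟨i, hi⟩⟩ := x
    have : i + (d - i) = d := by simp at hi; lia
    have hd' : (Finsupp.equivFunOnFinite.symm ![i, d - i]).degree = d := by
      simp [Finsupp.degree_eq_sum, this]
    exact Sigma.ext (Fin.ext hd') ((Fin.heq_ext_iff (congrArg (· + 1) hd')).2 (by simp))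

theorem card_exponent (m : ℕ) : Nat.card (Exponent m) = (m + 1) * (m + 2) / 2 := by
  rw [Nat.card_congr (exponentEquivSigma m), Nat.card_eq_fintype_card, Fintype.card_sigma]
  simp only [Fintype.card_fin]
  rw [Fin.sum_univ_eq_sum_range (fun d => d + 1) (m + 1)]
  -- Gauss's sum over `range (m + 2)`, whose zero term is then split off.
  have h := Finset.sum_range_id_mul_two (m + 2)
  rw [Finset.sum_range_succ', show m + 2 - 1 = m + 1 from rfl, mul_comm (m + 2)] at h
  rw [← h, add_zero, Nat.mul_div_cancel _ two_pos]

theorem card_posExponent (m : ℕ) : Nat.card (PosExponent m) = m * (m + 3) / 2 := by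
  classical
  have h : Nat.card {ν : Exponent m // ν = ⟨0, by simp⟩} + Nat.card (PosExponent m) =
      (m + 1) * (m + 2) / 2 := by
    rw [← card_exponent, ← Nat.card_sum]
    refine Nat.card_congr (Equiv.trans (Equiv.sumCongr (Equiv.refl _)
      (Equiv.subtypeEquivRight fun ν => ?_)) (Equiv.sumCompl _))
    rw [not_iff_not, Subtype.ext_iff]
  rw [Nat.card_unique, show (m + 1) * (m + 2) = m * (m + 3) + 2 by ring,
    Nat.add_div_right _ two_pos] at h
  lia

end Cardinality

end Wedge

/-! ### Smoothness of affine space and of affine bundles -/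

/-- A polynomial ring in finitely many variables is standard smooth of relative dimension the
number of variables. -/
theorem Algebra.isStandardSmoothOfRelativeDimension_mvPolynomial (R : Type*) [CommRing R]
    (σ : Type*) [Finite σ] :
    Algebra.IsStandardSmoothOfRelativeDimension (Nat.card σ) R (MvPolynomial σ R) := by
  -- With no relations, the Jacobian is the determinant of an empty matrix, namely `1`.
  let P : Algebra.SubmersivePresentation R (MvPolynomial σ R) σ PEmpty.{1} :=
    { Algebra.Generators.mvPolynomial R σ with
      relation := PEmpty.elim
      span_range_relation_eq_ker := by
        rw [Set.range_eq_empty, Ideal.span_empty]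
        exact Algebra.Generators.ker_mvPolynomial.symm
      map := PEmpty.elim
      map_inj := fun a => a.elim
      jacobian_isUnit := by
        rw [Algebra.PreSubmersivePresentation.jacobian_eq_jacobiMatrix_det, Matrix.det_isEmpty,
          map_one]
        exact isUnit_one }
  exact P.isStandardSmoothOfRelativeDimension (by simp [Algebra.Presentation.dimension])

namespace AlgebraicGeometry

/-- A polynomial ring is smooth over its coefficient ring, in terms of schemes. -/
theorem smoothOfRelativeDimension_SpecMap_C (R : CommRingCat.{u}) (σ : Type u) [Finite σ] :
    SmoothOfRelativeDimension (Nat.card σ)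
      (Spec.map (CommRingCat.ofHom (MvPolynomial.C : R →+* MvPolynomial σ R))) := by
  rw [HasRingHomProperty.Spec_iff (P := @SmoothOfRelativeDimension (Nat.card σ))]
  apply RingHom.locally_of RingHom.isStandardSmoothOfRelativeDimension_respectsIso
  exact (RingHom.isStandardSmoothOfRelativeDimension_algebraMap _).2
    (Algebra.isStandardSmoothOfRelativeDimension_mvPolynomial R σ)

theorem isZariskiLocalAtTarget_smoothOfRelativeDimension (r : ℕ) :
    IsZariskiLocalAtTarget (@SmoothOfRelativeDimension.{u} r) :=
  HasRingHomProperty.instIsZariskiLocalAtTarget (P := @SmoothOfRelativeDimension.{u} r)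
    (Q := RingHom.Locally (RingHom.IsStandardSmoothOfRelativeDimension r))

/-- Affine space of finite dimension is smooth over its base. -/
theorem smoothOfRelativeDimension_affineSpace (σ : Type u) [Finite σ] (S : Scheme.{u}) :
    SmoothOfRelativeDimension (Nat.card σ) (AffineSpace σ S ↘ S) := by
  have := (isZariskiLocalAtTarget_smoothOfRelativeDimension.{u} (Nat.card σ)).toRespects
  -- Every affine space is a base change of the one over `Spec ℤ`, lifted to universe `u`.
  have h := smoothOfRelativeDimension_SpecMap_C (.of (ULift.{u} ℤ)) σ
  rw [← AffineSpace.SpecIso_inv_over,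
    MorphismProperty.cancel_left_of_respectsIso (P := @SmoothOfRelativeDimension (Nat.card σ))] at h
  have := smoothOfRelativeDimension_isStableUnderBaseChange (Nat.card σ)
  exact MorphismProperty.of_isPullback
    (AffineSpace.isPullback_map (specULiftZIsTerminal.from S)) h

end AlgebraicGeometry

namespace Wedge

/-- Smoothness is local on the target, and over each trivializing open the map is an affine space up
to isomorphism. -/
theorem IsLocallyAffineBundle.smoothOfRelativeDimension {X Y : Scheme.{u}} {p : Y ⟶ X} {r : ℕ}
    (h : IsLocallyAffineBundle p r) : SmoothOfRelativeDimension r p := by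
  have := isZariskiLocalAtTarget_smoothOfRelativeDimension.{u} r
  have := this.toRespects
  refine IsZariskiLocalAtTarget.of_forall_exists_morphismRestrict
    (P := @SmoothOfRelativeDimension r) fun x => ?_
  obtain ⟨U, hx, e, he⟩ := h x
  refine ⟨U, hx, ?_⟩
  rw [← he, MorphismProperty.cancel_left_of_respectsIso (P := @SmoothOfRelativeDimension r)]
  simpa using smoothOfRelativeDimension_affineSpace (ULift.{u} (Fin r)) U.toScheme

/-! ### Local models of the projection and of affine space -/

section Affine

variable {k : Type u} [CommRing k] {X : Scheme.{u}} (f : X ⟶ Spec (.of k)) (m : ℕ)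

/-- Over an affine open `U`, the projection `π_m` is `Spec` of the structure map of the wedge
algebra of the sections over `U`. -/
theorem exists_preimage_iso {U : X.Opens} (hU : IsAffineOpen U) :
    letI := sectionsAlgebra f U
    ∃ e : (wedgeProj f m ⁻¹ᵁ U).toScheme ≅ Spec (.of (WedgeAlgebra k Γ(X, U) m)),
      e.hom ≫ Spec.map (CommRingCat.ofHom (base k Γ(X, U) m).toRingHom) =
        wedgeProj f m ∣_ U ≫ hU.isoSpec.hom := by
  let := sectionsAlgebra f U
  obtain ⟨i, h⟩ : ∃ i : Spec (.of (WedgeAlgebra k Γ(X, U) m)) ⟶ wedgeScheme f m, IsPullback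
      (Spec.map (CommRingCat.ofHom (base k Γ(X, U) m).toRingHom) ≫ hU.isoSpec.inv) i U.ι
      (wedgeProj f m) :=
    ⟨_, (wedgeGlueData f m).isPullback_natTrans_ι_toBase ⟨U, hU⟩⟩
  -- The gluing chart and the preimage of `U` are both pullbacks of `π_m` along `U.ι`.
  refine ⟨(isPullback_morphismRestrict (wedgeProj f m) U).isoIsPullback _ _ h, ?_⟩
  rw [← Iso.comp_inv_eq, Category.assoc]
  exact (IsPullback.isoIsPullback_hom_fst _ _ _ h)

end Affine

section AffineSpace

/-- Affine space over an affine open, as `Spec` of a polynomial ring. -/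
theorem exists_affineSpace_iso {X : Scheme.{u}} {U : X.Opens} (hU : IsAffineOpen U) (σ : Type u) :
    ∃ e : AffineSpace σ U.toScheme ≅ Spec (.of (MvPolynomial σ Γ(X, U))),
      e.hom ≫ Spec.map (CommRingCat.ofHom MvPolynomial.C) =
        (AffineSpace σ U.toScheme ↘ U.toScheme) ≫ hU.isoSpec.hom := by
  have := (AffineSpace.isPullback_map (n := σ) hU.isoSpec.hom).isIso_fst_of_isIso
  refine ⟨asIso (AffineSpace.map σ hU.isoSpec.hom) ≪≫ AffineSpace.SpecIso σ _, ?_⟩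
  have h := AffineSpace.SpecIso_inv_over (n := σ) Γ(X, U)
  rw [Iso.inv_comp_eq] at h
  rw [Iso.trans_hom, Category.assoc, asIso_hom, ← AffineSpace.map_over]
  exact congrArg (_ ≫ ·) h.symm

end AffineSpace

/-! ### Étale coordinates and the bundle structure -/

section Smooth

/-- A scheme smooth of relative dimension `n` over a field is covered by affine opens whose rings
of sections are étale over a polynomial ring in `n` variables. -/
theorem exists_etale_coordinates {k : Type u} [Field k] {X : Scheme.{u}}
    (f : X ⟶ Spec (.of k)) {n : ℕ} (hf : SmoothOfRelativeDimension n f) (x : X) :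
    ∃ U : X.Opens, IsAffineOpen U ∧ x ∈ U ∧
      letI := sectionsAlgebra f U
      ∃ g : MvPolynomial (Fin n) k →ₐ[k] Γ(X, U), g.toRingHom.Etale := by
  obtain ⟨V, -, U, hU, hxU, e, h⟩ := hf.exists_isStandardSmoothOfRelativeDimension x
  -- `Spec k` is a single point, so an open containing `f x` is everything.
  obtain rfl : V = ⊤ := by
    refine top_le_iff.1 fun y _ => ?_
    rw [Subsingleton.elim (α := PrimeSpectrum k) y (f x)]
    exact e hxU
  refine ⟨U, hU, hxU, ?_⟩
  let := sectionsAlgebra f U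
  have h' : (algebraMap k Γ(X, U)).IsStandardSmoothOfRelativeDimension n :=
    RingHom.isStandardSmoothOfRelativeDimension_respectsIso.2 _
      (Scheme.ΓSpecIso (.of k)).symm.commRingCatIsoToRingEquiv h
  rw [RingHom.isStandardSmoothOfRelativeDimension_algebraMap] at h'
  exact Algebra.IsStandardSmoothOfRelativeDimension.exists_etale_mvPolynomial n _ _

theorem isLocallyAffineBundle_wedgeProj {k : Type u} [Field k] {X : Scheme.{u}}
    (f : X ⟶ Spec (.of k)) {n : ℕ} (hf : SmoothOfRelativeDimension n f) (m : ℕ) :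
    IsLocallyAffineBundle (wedgeProj f m) (n * m * (m + 3) / 2) := by
  intro x
  obtain ⟨U, hU, hxU, g, hg⟩ := exists_etale_coordinates f hf x
  let := sectionsAlgebra f U
  obtain ⟨e, he⟩ := exists_wedgeAlgebra_equiv (k := k) hg.formallyEtale m
  obtain ⟨e₁, he₁⟩ := exists_preimage_iso f m hU
  obtain ⟨e₂, he₂⟩ := exists_affineSpace_iso hU (ULift.{u} (Fin (n * m * (m + 3) / 2)))
  have hcard : Nat.card (Fin n × PosExponent m) =
      Nat.card (ULift.{u} (Fin (n * m * (m + 3) / 2))) := by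
    -- Evenness of `m * (m + 3)` lets the factor `n` move inside the natural-number division.
    have : 2 ∣ m * (m + 3) := by
      rw [← even_iff_two_dvd]
      simp [parity_simps, m.even_or_odd]
    rw [Nat.card_prod, card_posExponent, Nat.card_ulift, Nat.card_fin, Nat.card_fin, mul_assoc,
      Nat.mul_div_assoc _ this]
  let e₃ : MvPolynomial (ULift.{u} (Fin (n * m * (m + 3) / 2))) Γ(X, U) ≃+*
      WedgeAlgebra k Γ(X, U) m :=
    (MvPolynomial.renameEquiv Γ(X, U) (Finite.card_eq.1 hcard).some.symm).toRingEquiv.trans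
      e.toRingEquiv
  have he₃ : e₃.toRingHom.comp MvPolynomial.C = (base k Γ(X, U) m).toRingHom :=
    RingHom.ext fun a => by simp [e₃, he]
  refine ⟨U, hxU, e₁ ≪≫ Scheme.Spec.mapIso e₃.toCommRingCatIso.op ≪≫ e₂.symm, ?_⟩
  -- After composing with `U ≅ Spec Γ(X, U)`, compatibility with the projections becomes the ring
  -- identity `he₃`.
  rw [← cancel_mono hU.isoSpec.hom, ← he₁, ← he₃]
  simp [← he₂]

end Smooth

end Wedge

/-- If `X` is smooth of dimension `n` over `k`, then `W_m(X)` is locally an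
`𝔸 ^ (n * m * (m + 3) / 2)`-bundle over `X`; in particular it is smooth over `k` of dimension
`n * (m + 1) * (m + 2) / 2`. (Both divisions by `2` are exact.) -/
theorem mainTheorem9 {k : Type u} [Field k] [IsAlgClosed k] [CharZero k] {X : Scheme.{u}}
    (f : X ⟶ Spec (.of k)) [LocallyOfFiniteType f] [QuasiCompact f] (n m : ℕ)
    (hf : SmoothOfRelativeDimension n f) :
    Wedge.IsLocallyAffineBundle (Wedge.wedgeProj f m) (n * m * (m + 3) / 2) ∧
      SmoothOfRelativeDimension (n * (m + 1) * (m + 2) / 2) (Wedge.wedgeProj f m ≫ f) := by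
  have h := Wedge.isLocallyAffineBundle_wedgeProj f hf m
  refine ⟨h, ?_⟩
  have := h.smoothOfRelativeDimension
  -- The fibre dimension plus `n`; the identity used is `(m + 1) * (m + 2) = m * (m + 3) + 2`.
  have hdim : n * m * (m + 3) / 2 + n = n * (m + 1) * (m + 2) / 2 := by
    rw [show n * (m + 1) * (m + 2) = n * m * (m + 3) + n * 2 by ring,
      Nat.add_mul_div_right _ _ two_pos]
  exact hdim ▸ smoothOfRelativeDimension_comp _ _ (Wedge.wedgeProj f m) f
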